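/- For a nonzero polynomial $P\in\mathbb C[x_1,\dots,x_N]$ let $$\mathrm m(P)=\int_{[0,1]^N}\log\bigl|P(e^{2\pi i\theta_1},\dots,e^{2\pi i\theta_N})\bigr|\,d\theta_1\cdots d\theta_N$$ denote its logarithmic Mahler measure, and let $${}_5F_4\biggl(\begin{matrix}a_1,\dots,a_5\\ b_1,\dots,b_4\end{matrix}\biggm|z\biggr)=\sum_{n=0}^\infty\frac{(a_1)_n\cdots(a_5)_n}{(b_1)_n\cdots(b_4)_n}\,\frac{z^n}{n!},\qquad (x)_n=x(x+1)\cdots(x+n-1),$$ denote the generalized hypergeometric series, which for $|z|<1$ and positive parameters converges. Then the integral defining $\mathrm m((1+x_1)^2+x_2+x_3)$ converges absolutely and $$\mathrm m\bigl((1+x_1)^2+x_2+x_3\bigr)=\frac{8\,\Gamma(\frac34)^2}{\pi^{5/2}}\;{}_5F_4\biggl(\begin{matrix}\frac14,\frac14,\frac14,\frac34,\frac34\\ \frac12,\frac54,\frac54,\frac54\end{matrix}\biggm|\frac14\biggr)+\frac{\Gamma(\frac14)^2}{54\,\pi^{5/2}}\;{}_5F_4\biggl(\begin{matrix}\frac34,\frac34,\frac34,\frac54,\frac54\\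 \frac32,\frac74,\frac74,\frac74\end{matrix}\biggm|\frac14\biggr).$$ -/

import Mathlib

open MeasureTheory

/-- The point `(e^{2πiθ₁}, …, e^{2πiθ_N})` of the `N`-dimensional torus. -/
noncomputable def torusPoint {N : ℕ} (θ : Fin N → ℝ) : Fin N → ℂ :=
  fun j => Complex.exp (2 * (Real.pi : ℂ) * Complex.I * (θ j : ℂ))

/-- The function `θ ↦ log |P(e^{2πiθ₁}, …, e^{2πiθ_N})|`. -/
noncomputable def logAbsOnTorus {N : ℕ} (P : MvPolynomial (Fin N) ℂ) (θ : Fin N → ℝ) : ℝ :=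
  Real.log ‖MvPolynomial.eval (torusPoint θ) P‖

/-- The logarithmic Mahler measure
`m(P) = ∫_{[0,1]^N} log |P(e^{2πiθ₁}, …, e^{2πiθ_N})| dθ₁ ⋯ dθ_N`
of a polynomial in `N` variables; the set `Set.Icc 0 1` is the cube `[0,1]^N`. -/
noncomputable def logMahlerMeasure {N : ℕ} (P : MvPolynomial (Fin N) ℂ) : ℝ :=
  ∫ θ in Set.Icc (0 : Fin N → ℝ) 1, logAbsOnTorus P θ

/-- The Pochhammer symbol `(x)_n = x (x + 1) ⋯ (x + n - 1)`. -/
noncomputable def pochhammer (x : ℝ) (n : ℕ) : ℝ :=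
  (ascPochhammer ℝ n).eval x

/-- The `n`-th term `(a₁)_n ⋯ (a_p)_n / ((b₁)_n ⋯ (b_q)_n) · z^n / n!` of the generalized
hypergeometric series with upper parameters `a` and lower parameters `b`. -/
noncomputable def hypergeometricTerm (a b : List ℝ) (z : ℝ) (n : ℕ) : ℝ :=
  (a.map fun x => pochhammer x n).prod / (b.map fun x => pochhammer x n).prod
    * (z ^ n / (n.factorial : ℝ))

/-- The generalized hypergeometric function `_pF_q(a₁, …, a_p; b₁, …, b_q; z)`, as the sum of
its series. -/
noncomputable def hypergeometric (a b : List ℝ) (z : ℝ) : ℝ :=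
  ∑' n : ℕ, hypergeometricTerm a b z n

/-! Two applications of Jensen's formula turn the measure into a double integral of a nonnegative
function. Integrating out `x₃` leaves the mean of `log⁺ |(1+x)² + y|`. For fixed `a = (1+x)² ≠ 0`,
the mean of `log⁺ |a + y|` over `y` is the Mahler measure of `a + y + z`; writing `z = wy` and
applying Jensen to `a + y(1+w)` in `y` gives the mean of `log |a| + log⁺(|1+w|/|a|)` over `w`
(`integral_posLog_norm_add_unitCircleExp`). Since `1+x` has Mahler measure zero, only
`log⁺(|1+w|/|1+x|²)` survives.

As `|1 + e^{2πit}| = 2|cos πt|`, this quotient is `(√σ/2)/τ` with `σ`, `τ` independent and arcsine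
distributed. The bound `√σ/2 < 1` confines `τ` to a region where `(1-τ)^(-1/2)` can be expanded and
integrated termwise (`lintegral_arcsineDensity_mul_posLog`); the `σ`-integrals are Beta values
(`lintegral_arcsineDensity_mul_rpow`). The terms of the resulting series satisfy a recurrence of
step two, so the even and odd terms form the two hypergeometric series.

Everything after Jensen is done with `lintegral`, so interchanges need only nonnegativity, and
finiteness is read off from the final series. -/

/-! ### Circle integrals and Jensen's formula -/

/-- Lebesgue measure on the unit interval. -/
noncomputable def unitIntervalMeasure : Measure ℝ := volume.restrict (Set.Icc 0 1)

instance : IsProbabilityMeasure unitIntervalMeasure :=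
  ⟨by simp [unitIntervalMeasure]⟩

/-- The parametrization `t ↦ e^{2πit}` of the unit circle. -/
noncomputable def unitCircleExp (t : ℝ) : ℂ :=
  Complex.exp (2 * (Real.pi : ℂ) * Complex.I * (t : ℂ))

@[fun_prop]
lemma continuous_unitCircleExp : Continuous unitCircleExp := by
  unfold unitCircleExp; fun_prop

@[fun_prop]
lemma measurable_unitCircleExp : Measurable unitCircleExp :=
  continuous_unitCircleExp.measurable

@[simp]
lemma norm_unitCircleExp (t : ℝ) : ‖unitCircleExp t‖ = 1 := by
  rw [unitCircleExp, show 2 * (Real.pi : ℂ) * Complex.I * (t : ℂ) =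
    ((2 * Real.pi * t : ℝ) : ℂ) * Complex.I by push_cast; ring, Complex.norm_exp_ofReal_mul_I]

lemma unitCircleExp_add (s t : ℝ) :
    unitCircleExp (s + t) = unitCircleExp s * unitCircleExp t := by
  simp only [unitCircleExp, ← Complex.exp_add]
  push_cast; ring_nf

lemma unitCircleExp_periodic : Function.Periodic unitCircleExp 1 := by
  intro t
  rw [unitCircleExp_add]
  simp [unitCircleExp, Complex.exp_two_pi_mul_I]

lemma circleMap_two_pi_mul (t : ℝ) :
    circleMap 0 1 (2 * Real.pi * t) = unitCircleExp t := by
  simp only [circleMap, unitCircleExp]; push_cast; ring_nf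

lemma integrable_unitIntervalMeasure_iff {f : ℝ → ℝ} :
    Integrable f unitIntervalMeasure ↔ IntervalIntegrable f volume 0 1 := by
  rw [unitIntervalMeasure, intervalIntegrable_iff_integrableOn_Icc_of_le zero_le_one]
  rfl

lemma integral_unitIntervalMeasure (f : ℝ → ℝ) :
    ∫ t, f t ∂unitIntervalMeasure = ∫ t in (0 : ℝ)..1, f t := by
  rw [unitIntervalMeasure, intervalIntegral.integral_of_le zero_le_one,
    integral_Icc_eq_integral_Ioc]

/-- Rotation invariance of the integral over the circle. -/
lemma integral_unitCircleExp_mul (f : ℂ → ℝ) (s : ℝ) :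
    ∫ t, f (unitCircleExp s * unitCircleExp t) ∂unitIntervalMeasure =
      ∫ t, f (unitCircleExp t) ∂unitIntervalMeasure := by
  simp only [integral_unitIntervalMeasure, ← unitCircleExp_add]
  rw [intervalIntegral.integral_comp_add_left (fun t => f (unitCircleExp t)) s]
  have h : Function.Periodic (fun t => f (unitCircleExp t)) 1 := fun t => by
    simp only [unitCircleExp_periodic t]
  simpa using h.intervalIntegral_add_eq (s + 0) 0

lemma integrable_log_norm_add_unitCircleExp (a : ℂ) :
    Integrable (fun t => Real.log ‖a + unitCircleExp t‖) unitIntervalMeasure := by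
  rw [integrable_unitIntervalMeasure_iff]
  have h := circleIntegrable_log_norm_sub_const (c := 0) (a := -a) 1
  rw [circleIntegrable_def] at h
  have h2 := h.comp_mul_left (c := 2 * Real.pi)
  have hpi : 2 * Real.pi ≠ 0 := by positivity
  simp only [zero_div, div_self hpi, circleMap_two_pi_mul, sub_neg_eq_add] at h2
  simpa only [add_comm] using h2

/-- **Jensen's formula** for a linear polynomial. -/
lemma integral_log_norm_add_unitCircleExp (a : ℂ) :
    ∫ t, Real.log ‖a + unitCircleExp t‖ ∂unitIntervalMeasure = Real.posLog ‖a‖ := by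
  rw [← circleAverage_log_norm_add_const_eq_posLog, Real.circleAverage_def,
    integral_unitIntervalMeasure]
  have hpi : 2 * Real.pi ≠ 0 := by positivity
  have := intervalIntegral.integral_comp_mul_left
    (fun θ => Real.log ‖circleMap 0 1 θ + a‖) (c := 2 * Real.pi) (a := 0) (b := 1) hpi
  simp only [mul_zero, mul_one] at this
  rw [← this]
  simp only [circleMap_two_pi_mul, add_comm]

lemma norm_add_mul_eq {a b : ℂ} (hb : ‖b‖ = 1) (z : ℂ) : ‖a + z * b‖ = ‖a / b + z‖ := by
  have hb0 : b ≠ 0 := by rintro rfl; simp at hb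
  rw [show a + z * b = (a / b + z) * b by field_simp, norm_mul, hb, mul_one]

lemma integrable_log_norm_add_unitCircleExp_mul (a : ℂ) {b : ℂ} (hb : ‖b‖ = 1) :
    Integrable (fun t => Real.log ‖a + unitCircleExp t * b‖) unitIntervalMeasure := by
  simp only [norm_add_mul_eq hb]
  exact integrable_log_norm_add_unitCircleExp _

lemma integral_log_norm_add_unitCircleExp_mul (a : ℂ) {b : ℂ} (hb : ‖b‖ = 1) :
    ∫ t, Real.log ‖a + unitCircleExp t * b‖ ∂unitIntervalMeasure = Real.posLog ‖a‖ := by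
  simp only [norm_add_mul_eq hb, integral_log_norm_add_unitCircleExp]
  rw [norm_div, hb, div_one]

lemma log_norm_le_of_norm_le {M : ℝ} (hM : 1 ≤ M) {z : ℂ} (hz : ‖z‖ ≤ M) :
    Real.log ‖z‖ ≤ Real.log M := by
  rcases eq_or_ne z 0 with rfl | h
  · simpa using Real.log_nonneg hM
  · exact Real.log_le_log (norm_pos_iff.2 h) hz

lemma integrable_posLog_norm {α : Type*} [MeasurableSpace α] (ν : Measure α)
    [IsFiniteMeasure ν] {F : α → ℂ} (hF : Measurable F) {M : ℝ} (hM : 1 ≤ M)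
    (hFM : ∀ x, ‖F x‖ ≤ M) : Integrable (fun x => Real.posLog ‖F x‖) ν := by
  refine Integrable.of_bound (C := Real.log M)
    (measurable_const.max (Real.measurable_log.comp hF.norm)).aestronglyMeasurable
    (.of_forall fun x => ?_)
  rw [Real.norm_of_nonneg Real.posLog_nonneg]
  exact max_le (Real.log_nonneg hM) (log_norm_le_of_norm_le hM (hFM x))

/-- Integrability of the logarithm of a polynomial that is linear with unimodular leading
coefficient in one of the variables. -/
lemma integrable_log_norm_add_unitCircleExp_prod {α : Type*} [MeasurableSpace α] (ν : Measure α)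
    [IsFiniteMeasure ν] {F G : α → ℂ} (hF : Measurable F) (hG : Measurable G)
    (hG1 : ∀ x, ‖G x‖ = 1) {M : ℝ} (hFM : ∀ x, ‖F x‖ ≤ M) :
    Integrable (fun p : α × ℝ => Real.log ‖F p.1 + unitCircleExp p.2 * G p.1‖)
      (ν.prod unitIntervalMeasure) := by
  have hmeas : Measurable fun p : α × ℝ => Real.log ‖F p.1 + unitCircleExp p.2 * G p.1‖ := by
    exact Real.measurable_log.comp ((hF.comp measurable_fst).add
      ((measurable_unitCircleExp.comp measurable_snd).mul (hG.comp measurable_fst))).norm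
  -- `|M| + 1` bounds the norm of the whole expression and is at least 1, so its logarithm is
  -- nonnegative.
  have hM : 1 ≤ |M| + 1 := by linarith [abs_nonneg M]
  have hle (p : α × ℝ) :
      Real.log ‖F p.1 + unitCircleExp p.2 * G p.1‖ ≤ Real.log (|M| + 1) := by
    refine log_norm_le_of_norm_le hM ((norm_add_le _ _).trans ?_)
    rw [norm_mul, hG1, norm_unitCircleExp]
    linarith [hFM p.1, le_abs_self M]
  rw [integrable_prod_iff hmeas.stronglyMeasurable.aestronglyMeasurable]
  have hsec : ∀ᵐ x ∂ν, Integrable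
      (fun t => Real.log ‖F x + unitCircleExp t * G x‖) unitIntervalMeasure :=
    .of_forall fun x => integrable_log_norm_add_unitCircleExp_mul (F x) (hG1 x)
  refine ⟨hsec, ?_⟩
  have hsm : AEStronglyMeasurable (fun x => ∫ t, ‖Real.log ‖F x + unitCircleExp t * G x‖‖
      ∂unitIntervalMeasure) ν :=
    hmeas.norm.stronglyMeasurable.integral_prod_right'.aestronglyMeasurable
  refine Integrable.of_bound (C := 2 * Real.log (|M| + 1)) hsm (.of_forall fun x => ?_)
  rw [Real.norm_of_nonneg (integral_nonneg fun _ => norm_nonneg _)]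
  have hi := integrable_log_norm_add_unitCircleExp_mul (F x) (hG1 x)
  -- With `f ≤ L` and `0 ≤ L` one has `|f| ≤ 2L - f`. Jensen gives `∫ f ≥ 0`, so the logarithmic
  -- singularities cost nothing and the bound is uniform in `x`.
  calc ∫ t, ‖Real.log ‖F x + unitCircleExp t * G x‖‖ ∂unitIntervalMeasure
      ≤ ∫ t, (2 * Real.log (|M| + 1) - Real.log ‖F x + unitCircleExp t * G x‖)
          ∂unitIntervalMeasure := by
        refine integral_mono hi.norm ((integrable_const _).sub hi) fun t => ?_
        have h0 := Real.log_nonneg hM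
        have h1 : Real.log ‖F x + unitCircleExp t * G x‖ ≤ Real.log (|M| + 1) := hle (x, t)
        exact abs_le.2 ⟨by linarith, by linarith⟩
    _ ≤ 2 * Real.log (|M| + 1) := by
        rw [integral_sub (integrable_const _) hi, integral_log_norm_add_unitCircleExp_mul _ (hG1 x)]
        simpa using Real.posLog_nonneg

lemma integral_log_norm_add_unitCircleExp_prod {α : Type*} [MeasurableSpace α] (ν : Measure α)
    [IsFiniteMeasure ν] {F G : α → ℂ} (hF : Measurable F) (hG : Measurable G)
    (hG1 : ∀ x, ‖G x‖ = 1) {M : ℝ} (hFM : ∀ x, ‖F x‖ ≤ M) :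
    ∫ p, Real.log ‖F p.1 + unitCircleExp p.2 * G p.1‖ ∂(ν.prod unitIntervalMeasure) =
      ∫ x, Real.posLog ‖F x‖ ∂ν := by
  rw [integral_prod _ (integrable_log_norm_add_unitCircleExp_prod ν hF hG hG1 hFM)]
  simp only [integral_log_norm_add_unitCircleExp_mul _ (hG1 _)]

lemma exists_eq_norm_mul_unitCircleExp (b : ℂ) :
    ∃ s, b = ‖b‖ * unitCircleExp s := by
  refine ⟨b.arg / (2 * Real.pi), ?_⟩
  conv_lhs => rw [← Complex.norm_mul_exp_arg_mul_I b]
  rw [unitCircleExp]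
  congr 2
  push_cast
  field_simp

/-- Rotation invariance absorbs the argument of `b`; what remains is the average of `log |z|` over
the circle with centre `a` and radius `‖b‖`. -/
lemma integral_log_norm_add_unitCircleExp_mul_of_ne (a : ℂ) {b : ℂ} (hb : b ≠ 0) :
    ∫ t, Real.log ‖a + unitCircleExp t * b‖ ∂unitIntervalMeasure =
      Real.log ‖b‖ + Real.posLog (‖a‖ / ‖b‖) := by
  obtain ⟨s, hs⟩ := exists_eq_norm_mul_unitCircleExp b
  have h1 (t : ℝ) : a + unitCircleExp t * b =
      a + ‖b‖ * (unitCircleExp s * unitCircleExp t) := by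
    conv_lhs => rw [hs]
    ring
  simp only [h1]
  rw [integral_unitCircleExp_mul (fun z => Real.log ‖a + ‖b‖ * z‖) s]
  have h2 := circleAverage_log_norm_sub_const_eq_log_radius_add_posLog (a := 0) (c := a)
    (norm_ne_zero_iff.2 hb)
  rw [sub_zero, inv_mul_eq_div] at h2
  rw [← h2, Real.circleAverage_def, integral_unitIntervalMeasure]
  have hpi : 2 * Real.pi ≠ 0 := by positivity
  have := intervalIntegral.integral_comp_mul_left
    (fun θ => Real.log ‖circleMap a ‖b‖ θ - 0‖) (c := 2 * Real.pi) (a := 0) (b := 1) hpi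
  simp only [mul_zero, mul_one] at this
  rw [← this]
  refine intervalIntegral.integral_congr fun t _ => ?_
  have h3 : circleMap a ‖b‖ (2 * Real.pi * t) = a + ‖b‖ * unitCircleExp t := by
    rw [← circleMap_two_pi_mul]; simp [circleMap]
  simp only [h3, sub_zero]

/-- Follows from `log⁺ r - log⁺ r⁻¹ = log r`. This form isolates `log ‖a‖`, which will integrate to
zero. -/
lemma integral_log_norm_add_unitCircleExp_mul_of_ne' {a b : ℂ} (ha : a ≠ 0) (hb : b ≠ 0) :
    ∫ t, Real.log ‖a + unitCircleExp t * b‖ ∂unitIntervalMeasure =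
      Real.log ‖a‖ + Real.posLog (‖b‖ / ‖a‖) := by
  rw [integral_log_norm_add_unitCircleExp_mul_of_ne a hb]
  have h := Real.posLog_sub_posLog_inv (x := ‖a‖ / ‖b‖)
  rw [inv_div, Real.log_div (norm_ne_zero_iff.2 ha) (norm_ne_zero_iff.2 hb)] at h
  linarith

/-! ### The factor `1 + e^{2πit}` and the measure of `a + y + z` -/

lemma norm_one_add_unitCircleExp (t : ℝ) :
    ‖1 + unitCircleExp t‖ = 2 * |Real.cos (Real.pi * t)| := by
  have h : 1 + unitCircleExp t =
      2 * Real.cos (Real.pi * t) * Complex.exp ((Real.pi * t : ℝ) * Complex.I) := by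
    rw [Complex.ofReal_cos, Complex.two_cos, add_mul, ← Complex.exp_add, ← Complex.exp_add,
      unitCircleExp, add_comm]
    congr 1
    · congr 1; push_cast; ring
    · rw [← Complex.exp_zero]; congr 1; push_cast; ring
  rw [h, norm_mul, norm_mul, Complex.norm_exp_ofReal_mul_I, Complex.norm_real, Real.norm_eq_abs]
  simp

lemma ae_one_add_unitCircleExp_ne_zero :
    ∀ᵐ t ∂unitIntervalMeasure, 1 + unitCircleExp t ≠ 0 := by
  rw [unitIntervalMeasure, ae_restrict_iff' measurableSet_Icc]
  filter_upwards [(Set.countable_singleton (1 / 2 : ℝ)).ae_notMem volume] with t ht h01 h0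
  have h1 : Real.cos (Real.pi * t) = 0 := by
    have := norm_one_add_unitCircleExp t
    rw [h0, norm_zero] at this
    exact abs_eq_zero.1 (by linarith)
  have hpi := Real.pi_pos
  apply ht
  have h2 : Real.cos (Real.pi * t) = Real.cos (Real.pi / 2) := by rw [h1, Real.cos_pi_div_two]
  have h3 := Real.injOn_cos ⟨by nlinarith [h01.1], by nlinarith [h01.2]⟩
    ⟨by positivity, by linarith⟩ h2
  have : t = 1 / 2 := by
    apply mul_left_cancel₀ hpi.ne'; linarith
  simpa using this

lemma norm_one_add_unitCircleExp_le (t : ℝ) : ‖1 + unitCircleExp t‖ ≤ 2 := by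
  rw [norm_one_add_unitCircleExp]
  linarith [Real.abs_cos_le_one (Real.pi * t)]

lemma integral_log_norm_one_add_unitCircleExp :
    ∫ t, Real.log ‖1 + unitCircleExp t‖ ∂unitIntervalMeasure = 0 := by
  rw [integral_log_norm_add_unitCircleExp]; simp

/-- The two-variable Mahler measure of `a + y + z`, for a nonzero constant `a`. -/
lemma integral_posLog_norm_add_unitCircleExp {a : ℂ} (ha : a ≠ 0) :
    ∫ t, Real.posLog ‖a + unitCircleExp t‖ ∂unitIntervalMeasure =
      ∫ w, (Real.log ‖a‖ + Real.posLog (‖1 + unitCircleExp w‖ / ‖a‖)) ∂unitIntervalMeasure := by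
  have hF : Measurable fun t => a + unitCircleExp t := by fun_prop
  have hM (t : ℝ) : ‖a + unitCircleExp t‖ ≤ ‖a‖ + 1 := by
    simpa using norm_add_le a (unitCircleExp t)
  have hi := integrable_log_norm_add_unitCircleExp_prod unitIntervalMeasure hF
    measurable_unitCircleExp norm_unitCircleExp hM
  -- Jensen is undone with leading coefficient `e^{2πit}` instead of 1. After swapping the order,
  -- the integrand is linear in `e^{2πit}` with leading coefficient `1 + e^{2πiw}`, nonzero for
  -- almost every `w`.
  rw [← integral_log_norm_add_unitCircleExp_prod unitIntervalMeasure hF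
    measurable_unitCircleExp norm_unitCircleExp hM, integral_prod_symm _ hi]
  refine integral_congr_ae ?_
  filter_upwards [ae_one_add_unitCircleExp_ne_zero] with w hw
  rw [← integral_log_norm_add_unitCircleExp_mul_of_ne' ha hw]
  refine integral_congr_ae (.of_forall fun t => ?_)
  simp only
  congr 2
  ring

/-! ### Absolute convergence and reduction to a nonnegative double integral -/

lemma restrict_Icc_eq_pi (n : ℕ) :
    (volume : Measure (Fin n → ℝ)).restrict (Set.Icc 0 1) =
      Measure.pi fun _ => unitIntervalMeasure := by
  rw [← Set.pi_univ_Icc, volume_pi, Measure.restrict_pi_pi]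
  rfl

lemma logAbsOnTorus_eq (θ : Fin 3 → ℝ) :
    logAbsOnTorus ((1 + MvPolynomial.X 0) ^ 2 + MvPolynomial.X 1 + MvPolynomial.X 2 :
      MvPolynomial (Fin 3) ℂ) θ =
      Real.log ‖((1 + unitCircleExp (θ 0)) ^ 2 + unitCircleExp (θ 1)) +
        unitCircleExp (θ 2) * 1‖ := by
  simp [logAbsOnTorus, torusPoint, unitCircleExp]

/-- The measure preserving map splitting off the last of three coordinates. -/
noncomputable def splitLast : (Fin 3 → ℝ) ≃ᵐ (ℝ × ℝ) × ℝ :=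
  ((MeasurableEquiv.piFinSuccAbove (fun _ => ℝ) 2).trans MeasurableEquiv.prodComm).trans
    (MeasurableEquiv.prodCongr MeasurableEquiv.finTwoArrow (MeasurableEquiv.refl ℝ))

lemma measurePreserving_splitLast :
    MeasurePreserving splitLast (Measure.pi fun _ => unitIntervalMeasure)
      ((unitIntervalMeasure.prod unitIntervalMeasure).prod unitIntervalMeasure) := by
  have h1 := measurePreserving_piFinSuccAbove (fun _ : Fin 3 => unitIntervalMeasure) 2
  have h2 := Measure.measurePreserving_swap (μ := unitIntervalMeasure)
    (ν := Measure.pi fun _ : Fin 2 => unitIntervalMeasure)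
  have h3 := (measurePreserving_finTwoArrow unitIntervalMeasure).prod
    (MeasurePreserving.id unitIntervalMeasure)
  exact h3.comp (h2.comp h1)

lemma measurable_sq_add :
    Measurable fun p : ℝ × ℝ => (1 + unitCircleExp p.1) ^ 2 + unitCircleExp p.2 := by fun_prop

lemma norm_sq_add_le (p : ℝ × ℝ) :
    ‖(1 + unitCircleExp p.1) ^ 2 + unitCircleExp p.2‖ ≤ 5 := by
  refine (norm_add_le _ _).trans ?_
  rw [norm_pow, norm_unitCircleExp]
  nlinarith [norm_one_add_unitCircleExp_le p.1, norm_nonneg (1 + unitCircleExp p.1)]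

lemma integrableOn_logAbsOnTorus :
    IntegrableOn
      (logAbsOnTorus ((1 + MvPolynomial.X 0) ^ 2 + MvPolynomial.X 1 + MvPolynomial.X 2 :
        MvPolynomial (Fin 3) ℂ)) (Set.Icc (0 : Fin 3 → ℝ) 1) volume := by
  rw [IntegrableOn, restrict_Icc_eq_pi]
  have h := integrable_log_norm_add_unitCircleExp_prod
    (unitIntervalMeasure.prod unitIntervalMeasure) measurable_sq_add
    (measurable_const (a := (1 : ℂ))) (fun _ => norm_one) norm_sq_add_le
  have h2 := (measurePreserving_splitLast.integrable_comp_emb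
    splitLast.measurableEmbedding).2 h
  exact h2.congr (.of_forall fun θ => (logAbsOnTorus_eq θ).symm)

lemma logMahlerMeasure_eq_integral_posLog :
    logMahlerMeasure ((1 + MvPolynomial.X 0) ^ 2 + MvPolynomial.X 1 + MvPolynomial.X 2 :
        MvPolynomial (Fin 3) ℂ) =
      ∫ x, ∫ t, Real.posLog ‖(1 + unitCircleExp x) ^ 2 + unitCircleExp t‖
        ∂unitIntervalMeasure ∂unitIntervalMeasure := by
  have hi : Integrable (fun p : ℝ × ℝ => Real.posLog
      ‖(1 + unitCircleExp p.1) ^ 2 + unitCircleExp p.2‖)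
      (unitIntervalMeasure.prod unitIntervalMeasure) :=
    integrable_posLog_norm _ measurable_sq_add (by norm_num) norm_sq_add_le
  rw [← integral_prod (fun p : ℝ × ℝ => Real.posLog
      ‖(1 + unitCircleExp p.1) ^ 2 + unitCircleExp p.2‖) hi,
    ← integral_log_norm_add_unitCircleExp_prod
    (unitIntervalMeasure.prod unitIntervalMeasure) measurable_sq_add
    (measurable_const (a := (1 : ℂ))) (fun _ => norm_one) norm_sq_add_le,
    logMahlerMeasure, restrict_Icc_eq_pi,
    ← measurePreserving_splitLast.integral_comp splitLast.measurableEmbedding]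
  exact integral_congr_ae (.of_forall logAbsOnTorus_eq)

lemma measurable_posLog_div : Measurable fun p : ℝ × ℝ =>
    Real.posLog (‖1 + unitCircleExp p.2‖ / ‖1 + unitCircleExp p.1‖ ^ 2) := by
  have h : Measurable fun p : ℝ × ℝ => ‖1 + unitCircleExp p.2‖ / ‖1 + unitCircleExp p.1‖ ^ 2 := by
    fun_prop
  exact measurable_const.max (Real.measurable_log.comp h)

/-- The extra term `2 log |1+x|` drops out because its mean is zero. The finiteness hypothesis,
needed to separate the two terms, is later supplied by the convergent series. -/
lemma logMahlerMeasure_eq_toReal_lintegral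
    (hfin : ∫⁻ p : ℝ × ℝ, ENNReal.ofReal (Real.posLog
      (‖1 + unitCircleExp p.2‖ / ‖1 + unitCircleExp p.1‖ ^ 2))
      ∂(unitIntervalMeasure.prod unitIntervalMeasure) ≠ ⊤) :
    logMahlerMeasure ((1 + MvPolynomial.X 0) ^ 2 + MvPolynomial.X 1 + MvPolynomial.X 2 :
        MvPolynomial (Fin 3) ℂ) =
      (∫⁻ p : ℝ × ℝ, ENNReal.ofReal (Real.posLog
        (‖1 + unitCircleExp p.2‖ / ‖1 + unitCircleExp p.1‖ ^ 2))
        ∂(unitIntervalMeasure.prod unitIntervalMeasure)).toReal := by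
  have hnn : 0 ≤ᵐ[unitIntervalMeasure.prod unitIntervalMeasure] fun p : ℝ × ℝ => Real.posLog
      (‖1 + unitCircleExp p.2‖ / ‖1 + unitCircleExp p.1‖ ^ 2) :=
    .of_forall fun _ => Real.posLog_nonneg
  have hsm := measurable_posLog_div.stronglyMeasurable.aestronglyMeasurable
    (μ := unitIntervalMeasure.prod unitIntervalMeasure)
  have hi : Integrable (fun p : ℝ × ℝ => Real.posLog
      (‖1 + unitCircleExp p.2‖ / ‖1 + unitCircleExp p.1‖ ^ 2))
      (unitIntervalMeasure.prod unitIntervalMeasure) :=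
    (lintegral_ofReal_ne_top_iff_integrable hsm hnn).1 hfin
  rw [← integral_eq_lintegral_of_nonneg_ae hnn hsm, logMahlerMeasure_eq_integral_posLog]
  have h1 : ∀ᵐ x ∂unitIntervalMeasure,
      ∫ t, Real.posLog ‖(1 + unitCircleExp x) ^ 2 + unitCircleExp t‖ ∂unitIntervalMeasure =
        2 * Real.log ‖1 + unitCircleExp x‖ + ∫ w, Real.posLog
          (‖1 + unitCircleExp w‖ / ‖1 + unitCircleExp x‖ ^ 2) ∂unitIntervalMeasure := by
    filter_upwards [ae_one_add_unitCircleExp_ne_zero, hi.prod_right_ae] with x hx hix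
    rw [integral_posLog_norm_add_unitCircleExp (pow_ne_zero 2 hx), norm_pow,
      integral_add (integrable_const _) hix, Real.log_pow]
    simp
  rw [integral_congr_ae h1, integral_add
    ((integrable_log_norm_add_unitCircleExp 1).const_mul 2) hi.integral_prod_left,
    integral_const_mul, integral_log_norm_one_add_unitCircleExp, integral_prod _ hi]
  simp

/-! ### The arcsine distribution -/

/-- The density of the arcsine distribution on `(0, 1)`. -/
noncomputable def arcsineDensity (t : ℝ) : ℝ :=
  Real.pi⁻¹ * t ^ (-(1 / 2) : ℝ) * (1 - t) ^ (-(1 / 2) : ℝ)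

lemma sq_rpow_neg_half {x : ℝ} (hx : 0 ≤ x) : (x ^ 2) ^ (-(1 / 2) : ℝ) = x⁻¹ := by
  rw [Real.rpow_neg (sq_nonneg x), ← Real.sqrt_eq_rpow, Real.sqrt_sq hx]

lemma image_cos_sq :
    (fun t => Real.cos (Real.pi * t) ^ 2) '' Set.Ioo 0 (1 / 2) = Set.Ioo 0 1 := by
  have hpi := Real.pi_pos
  ext τ
  constructor
  · rintro ⟨t, ⟨h0, h1⟩, rfl⟩
    have hc : 0 < Real.cos (Real.pi * t) :=
      Real.cos_pos_of_mem_Ioo ⟨by nlinarith, by nlinarith⟩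
    have hs : 0 < Real.sin (Real.pi * t) :=
      Real.sin_pos_of_pos_of_lt_pi (by positivity) (by nlinarith)
    exact ⟨by positivity, by nlinarith [Real.sin_sq_add_cos_sq (Real.pi * t)]⟩
  · rintro ⟨h0, h1⟩
    have hs0 : 0 < √τ := Real.sqrt_pos.2 h0
    have hs1 : √τ < 1 := (Real.sqrt_lt' one_pos).2 (by simpa using h1)
    refine ⟨Real.arccos √τ / Real.pi, ⟨?_, ?_⟩, ?_⟩
    · exact div_pos (Real.arccos_pos.2 hs1) hpi
    · rw [div_lt_iff₀ hpi]
      linarith [Real.arccos_lt_pi_div_two.2 hs0]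
    · simp only
      rw [mul_div_cancel₀ _ hpi.ne', Real.cos_arccos (by linarith) hs1.le, Real.sq_sqrt h0.le]

lemma injOn_cos_sq :
    Set.InjOn (fun t => Real.cos (Real.pi * t) ^ 2) (Set.Ioo 0 (1 / 2)) := by
  have hpi := Real.pi_pos
  intro s hs t ht hst
  have hpos {u : ℝ} (hu : u ∈ Set.Ioo (0 : ℝ) (1 / 2)) : 0 ≤ Real.cos (Real.pi * u) :=
    Real.cos_nonneg_of_mem_Icc ⟨by nlinarith [hu.1], by nlinarith [hu.2]⟩
  have h := (pow_left_inj₀ (hpos hs) (hpos ht) two_ne_zero).1 hst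
  have h2 := Real.injOn_cos ⟨by nlinarith [hs.1], by nlinarith [hs.2]⟩
    ⟨by nlinarith [ht.1], by nlinarith [ht.2]⟩ h
  exact mul_left_cancel₀ hpi.ne' h2

/-- Substitution `τ = cos² πt`, injective on the half interval: the Jacobian `2π cos sin` times the
density `1/(π cos sin)` is 2. -/
lemma two_mul_setLIntegral_cos_sq (h : ℝ → ENNReal) :
    2 * ∫⁻ t in Set.Ioo 0 (1 / 2), h (Real.cos (Real.pi * t) ^ 2) =
      ∫⁻ τ in Set.Ioo 0 1, ENNReal.ofReal (arcsineDensity τ) * h τ := by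
  have hpi := Real.pi_pos
  rw [← image_cos_sq, lintegral_image_eq_lintegral_abs_deriv_mul measurableSet_Ioo
    (f' := fun t => 2 * Real.cos (Real.pi * t) * (-Real.sin (Real.pi * t) * Real.pi)) ?_
    injOn_cos_sq, ← lintegral_const_mul' _ _ (by simp)]
  · refine setLIntegral_congr_fun measurableSet_Ioo fun t ⟨h0, h1⟩ => ?_
    have hc : 0 < Real.cos (Real.pi * t) :=
      Real.cos_pos_of_mem_Ioo ⟨by nlinarith, by nlinarith⟩
    have hs : 0 < Real.sin (Real.pi * t) :=
      Real.sin_pos_of_pos_of_lt_pi (by positivity) (by nlinarith)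
    rw [← mul_assoc, ← ENNReal.ofReal_mul (abs_nonneg _), arcsineDensity,
      ← Real.sin_sq, sq_rpow_neg_half hc.le, sq_rpow_neg_half hs.le]
    congr 1
    rw [abs_mul, abs_mul, abs_mul, abs_neg, abs_of_pos hc, abs_of_pos hs, abs_of_pos hpi]
    have : |(2 : ℝ)| * Real.cos (Real.pi * t) * (Real.sin (Real.pi * t) * Real.pi) *
        (Real.pi⁻¹ * (Real.cos (Real.pi * t))⁻¹ * (Real.sin (Real.pi * t))⁻¹) = 2 := by
      rw [abs_two]; field_simp
    rw [this]; simp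
  · intro t _
    have h1 : HasDerivAt (fun t : ℝ => Real.pi * t) Real.pi t := by
      simpa using (hasDerivAt_id t).const_mul Real.pi
    have h2 := (h1.cos.pow 2).hasDerivWithinAt (s := Set.Ioo 0 (1 / 2))
    convert! h2 using 1
    ring

/-- For `t` uniformly distributed on `[0, 1]`, the variable `cos² (π t)` has the arcsine
distribution. -/
lemma lintegral_cos_sq (h : ℝ → ENNReal) :
    ∫⁻ t, h (Real.cos (Real.pi * t) ^ 2) ∂unitIntervalMeasure =
      ∫⁻ τ in Set.Ioo 0 1, ENNReal.ofReal (arcsineDensity τ) * h τ := by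
  rw [← two_mul_setLIntegral_cos_sq, two_mul]
  -- The symmetry `t ↦ 1 - t` makes both halves of the interval contribute equally.
  have hrefl : ∫⁻ t in Set.Ioo (1 / 2) 1, h (Real.cos (Real.pi * t) ^ 2) =
      ∫⁻ t in Set.Ioo 0 (1 / 2), h (Real.cos (Real.pi * t) ^ 2) := by
    have h1 := ((volume : Measure ℝ).measurePreserving_sub_left 1).setLIntegral_comp_preimage_emb
      (MeasurableEquiv.subLeft (1 : ℝ)).measurableEmbedding
      (fun t => h (Real.cos (Real.pi * t) ^ 2)) (Set.Ioo 0 (1 / 2))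
    rw [← h1]
    have h2 : (fun t : ℝ => 1 - t) ⁻¹' Set.Ioo 0 (1 / 2) = Set.Ioo (1 / 2) 1 := by
      rw [Set.preimage_const_sub_Ioo]; norm_num
    rw [h2]
    refine setLIntegral_congr_fun measurableSet_Ioo fun t _ => ?_
    rw [mul_sub, mul_one, Real.cos_pi_sub, neg_sq]
  nth_rewrite 2 [← hrefl]
  rw [unitIntervalMeasure, ← setLIntegral_congr (Ioo_ae_eq_Icc (a := (0 : ℝ)) (b := 1)),
    setLIntegral_congr (Ioo_ae_eq_Ioc (a := (0 : ℝ)) (b := 1)),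
    setLIntegral_congr (Ioo_ae_eq_Ioc (a := (0 : ℝ)) (b := 1 / 2)),
    setLIntegral_congr (Ioo_ae_eq_Ioc (a := (1 / 2 : ℝ)) (b := 1)),
    ← lintegral_union measurableSet_Ioc (Set.Ioc_disjoint_Ioc_of_le le_rfl),
    Set.Ioc_union_Ioc_eq_Ioc (by norm_num) (by norm_num)]

/-! ### Termwise integration against the arcsine density -/

lemma lintegral_rpow_mul_log {c p : ℝ} (hc : 0 < c) (hp : 0 < p) :
    ∫⁻ t in Set.Ioo 0 c, ENNReal.ofReal (t ^ (p - 1) * Real.log (c / t)) =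
      ENNReal.ofReal (c ^ p / p ^ 2) := by
  -- The antiderivative `t^p log(c/t)/p + t^p/p²` from integration by parts, with the logarithm
  -- split so that continuity at 0 reduces to `t^p log t → 0`. Nonnegativity of its derivative then
  -- yields integrability.
  set Φ : ℝ → ℝ := fun t => (Real.log c * t ^ p - Real.log t * t ^ p) / p + t ^ p / p ^ 2 with hΦ
  have hpow : ContinuousOn (fun t : ℝ => t ^ p) (Set.Icc 0 c) :=
    (Real.continuous_rpow_const hp.le).continuousOn
  have hlog : ContinuousOn (fun t : ℝ => Real.log t * t ^ p) (Set.Icc 0 c) := by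
    intro t ht
    rcases ht.1.eq_or_lt with rfl | h0
    · have h1 := tendsto_log_mul_rpow_nhdsGT_zero hp
      have h2 : ContinuousWithinAt (fun t : ℝ => Real.log t * t ^ p) (Set.Ioi 0) 0 := by
        rw [ContinuousWithinAt]; simpa using h1
      exact (continuousWithinAt_Ioi_iff_Ici.1 h2).mono Set.Icc_subset_Ici_self
    · exact ((Real.continuousAt_log h0.ne').mul
        (Real.continuousAt_rpow_const _ _ (.inl h0.ne'))).continuousWithinAt
  have hcont : ContinuousOn Φ (Set.Icc 0 c) :=
    (((continuousOn_const.mul hpow).sub hlog).div_const _).add (hpow.div_const _)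
  have hderiv : ∀ t ∈ Set.Ioo 0 c, HasDerivAt Φ (t ^ (p - 1) * Real.log (c / t)) t := by
    rintro t ⟨h0, -⟩
    have h1 := Real.hasDerivAt_rpow_const (p := p) (.inl h0.ne')
    have h2 := (((h1.const_mul (Real.log c)).sub ((Real.hasDerivAt_log h0.ne').mul h1)).div_const
      p).add (h1.div_const (p ^ 2))
    convert! h2 using 1
    rw [Real.log_div hc.ne' h0.ne', Real.rpow_sub_one h0.ne']
    field_simp
    ring
  have hnn : ∀ t ∈ Set.Ioo 0 c, 0 ≤ t ^ (p - 1) * Real.log (c / t) := fun t ht =>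
    mul_nonneg (Real.rpow_nonneg ht.1.le _)
      (Real.log_nonneg ((one_le_div ht.1).2 ht.2.le))
  have hint : IntegrableOn (fun t : ℝ => t ^ (p - 1) * Real.log (c / t)) (Set.Ioc 0 c) :=
    intervalIntegral.integrableOn_deriv_of_nonneg hcont hderiv hnn
  have hint2 : IntervalIntegrable (fun t : ℝ => t ^ (p - 1) * Real.log (c / t)) volume 0 c :=
    (intervalIntegrable_iff_integrableOn_Ioc_of_le hc.le).2 hint
  have hval := intervalIntegral.integral_eq_sub_of_hasDerivAt_of_le hc.le hcont hderiv hint2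
  rw [intervalIntegral.integral_of_le hc.le, integral_Ioc_eq_integral_Ioo] at hval
  rw [← ofReal_integral_eq_lintegral_ofReal (hint.mono_set Set.Ioo_subset_Ioc_self), hval]
  · congr 1
    simp only [hΦ, Real.zero_rpow hp.ne']
    ring
  · exact (ae_restrict_iff' measurableSet_Ioo).2 (.of_forall hnn)

/-- The coefficients of the power series of `(1 - t) ^ (-1/2)`. -/
noncomputable def invSqrtCoeff (n : ℕ) : ℝ :=
  pochhammer (1 / 2) n / n.factorial

lemma invSqrtCoeff_nonneg (n : ℕ) : 0 ≤ invSqrtCoeff n :=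
  div_nonneg ((ascPochhammer_pos n _ (by norm_num)).le) (Nat.cast_nonneg _)

lemma hasSum_invSqrtCoeff {t : ℝ} (ht : |t| < 1) :
    HasSum (fun n => invSqrtCoeff n * t ^ n) ((1 - t) ^ (-(1 / 2) : ℝ)) := by
  have h := (Real.one_div_one_sub_rpow_hasFPowerSeriesOnBall_zero (1 / 2)).hasSum (y := t)
    (by simpa [enorm_eq_nnnorm, ← NNReal.coe_lt_coe] using ht)
  rw [zero_add, one_div ((1 - t) ^ (1 / 2 : ℝ)),
    ← Real.rpow_neg (by linarith [(abs_lt.1 ht).2])] at h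
  convert! h using 1
  funext n
  have h1 := Ring.factorial_nsmul_multichoose_eq_ascPochhammer (1 / 2 : ℝ) n
  rw [Polynomial.ascPochhammer_smeval_eq_eval, nsmul_eq_mul, Ring.multichoose_eq] at h1
  have h2 : (n.factorial : ℝ) ≠ 0 := by positivity
  rw [invSqrtCoeff, pochhammer, ← h1]
  simp [FormalMultilinearSeries.ofScalars, mul_div_cancel_left₀ _ h2]

/-- The integrand vanishes for `t ≥ c`; on `(0, c)` the binomial series of `(1-t)^(-1/2)` converges
with nonnegative terms, so sum and integral commute, and each term is `lintegral_rpow_mul_log` with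
`p = n + 1/2`. -/
lemma lintegral_arcsineDensity_mul_posLog {c : ℝ} (hc : 0 < c) (hc1 : c < 1) :
    ∫⁻ t in Set.Ioo 0 1, ENNReal.ofReal (arcsineDensity t) *
        ENNReal.ofReal (Real.posLog (c / t)) =
      ∑' n : ℕ, ENNReal.ofReal (Real.pi⁻¹ * invSqrtCoeff n *
        (c ^ (n + 1 / 2 : ℝ) / (n + 1 / 2) ^ 2)) := by
  have hpi := Real.pi_pos
  have h1 : ∫⁻ t in Set.Ioo 0 1, ENNReal.ofReal (arcsineDensity t) *
        ENNReal.ofReal (Real.posLog (c / t)) =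
      ∫⁻ t in Set.Ioo 0 c, ∑' n : ℕ, ENNReal.ofReal (Real.pi⁻¹ * invSqrtCoeff n) *
        ENNReal.ofReal (t ^ ((n + 1 / 2 : ℝ) - 1) * Real.log (c / t)) := by
    rw [← lintegral_indicator measurableSet_Ioo, ← lintegral_indicator measurableSet_Ioo]
    congr 1
    funext t
    by_cases ht : t ∈ Set.Ioo 0 c
    · have ht1 : t ∈ Set.Ioo (0 : ℝ) 1 := ⟨ht.1, ht.2.trans hc1⟩
      have h0 := ht.1
      have hlog : 0 ≤ Real.log (c / t) := Real.log_nonneg ((one_le_div ht.1).2 ht.2.le)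
      rw [Set.indicator_of_mem ht, Set.indicator_of_mem ht1, Real.posLog, max_eq_right hlog]
      have hs := (hasSum_invSqrtCoeff (t := t) (by rw [abs_of_pos h0]; exact ht1.2)).mul_left
        (Real.pi⁻¹ * t ^ (-(1 / 2) : ℝ) * Real.log (c / t))
      have hterm (n : ℕ) : ENNReal.ofReal (Real.pi⁻¹ * invSqrtCoeff n) *
          ENNReal.ofReal (t ^ ((n + 1 / 2 : ℝ) - 1) * Real.log (c / t)) =
          ENNReal.ofReal (Real.pi⁻¹ * t ^ (-(1 / 2) : ℝ) * Real.log (c / t) *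
            (invSqrtCoeff n * t ^ n)) := by
        rw [← ENNReal.ofReal_mul (mul_nonneg (by positivity) (invSqrtCoeff_nonneg n)),
          show (n + 1 / 2 : ℝ) - 1 = n + -(1 / 2) by ring, Real.rpow_add h0, Real.rpow_natCast]
        congr 1
        ring
      simp only [hterm]
      rw [← ENNReal.ofReal_tsum_of_nonneg _ hs.summable, hs.tsum_eq, arcsineDensity,
        ← ENNReal.ofReal_mul]
      · congr 1; ring
      · have := ht1.2
        have : 0 ≤ 1 - t := by linarith
        positivity
      · intro n
        have := invSqrtCoeff_nonneg n
        positivity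
    · rw [Set.indicator_of_notMem ht]
      by_cases ht1 : t ∈ Set.Ioo (0 : ℝ) 1
      · rw [Set.indicator_of_mem ht1, Real.posLog_eq_zero_iff _ |>.2, ENNReal.ofReal_zero, mul_zero]
        rw [abs_of_pos (div_pos hc ht1.1), div_le_one ht1.1]
        by_contra! h
        exact ht ⟨ht1.1, h⟩
      · rw [Set.indicator_of_notMem ht1]
  rw [h1, lintegral_tsum fun n => by fun_prop]
  congr 1
  funext n
  rw [lintegral_const_mul' _ _ ENNReal.ofReal_ne_top, lintegral_rpow_mul_log hc (by positivity),
    ← ENNReal.ofReal_mul (mul_nonneg (by positivity) (invSqrtCoeff_nonneg n))]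

/-- Read off from the normalization of the Beta distribution. -/
lemma setLIntegral_beta {a b : ℝ} (ha : 0 < a) (hb : 0 < b) :
    ∫⁻ t in Set.Ioo (0 : ℝ) 1, ENNReal.ofReal (t ^ (a - 1) * (1 - t) ^ (b - 1)) =
      ENNReal.ofReal (ProbabilityTheory.beta a b) := by
  have hpos := ProbabilityTheory.beta_pos ha hb
  have h := ProbabilityTheory.lintegral_betaPDF_eq_one ha hb
  rw [ProbabilityTheory.lintegral_betaPDF] at h
  have h2 : ∫⁻ t in Set.Ioo (0 : ℝ) 1, ENNReal.ofReal (t ^ (a - 1) * (1 - t) ^ (b - 1)) =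
      ENNReal.ofReal (ProbabilityTheory.beta a b) * ∫⁻ t in Set.Ioo (0 : ℝ) 1, ENNReal.ofReal
        (1 / ProbabilityTheory.beta a b * t ^ (a - 1) * (1 - t) ^ (b - 1)) := by
    rw [← lintegral_const_mul' _ _ ENNReal.ofReal_ne_top]
    congr 1
    funext t
    rw [← ENNReal.ofReal_mul hpos.le]
    congr 1
    field_simp
  rw [h2, h, mul_one]

/-- The moments of the arcsine distribution. -/
lemma lintegral_arcsineDensity_mul_rpow {s : ℝ} (hs : 0 ≤ s) :
    ∫⁻ t in Set.Ioo 0 1, ENNReal.ofReal (arcsineDensity t) * ENNReal.ofReal (√t ^ s) =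
      ENNReal.ofReal (Real.Gamma (s / 2 + 1 / 2) / (√Real.pi * Real.Gamma (s / 2 + 1))) := by
  have hpi := Real.pi_pos
  have h1 : ∫⁻ t in Set.Ioo 0 1, ENNReal.ofReal (arcsineDensity t) * ENNReal.ofReal (√t ^ s) =
      ENNReal.ofReal Real.pi⁻¹ * ∫⁻ t in Set.Ioo (0 : ℝ) 1,
        ENNReal.ofReal (t ^ ((s / 2 + 1 / 2) - 1) * (1 - t) ^ ((1 / 2 : ℝ) - 1)) := by
    rw [← lintegral_const_mul' _ _ ENNReal.ofReal_ne_top]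
    refine setLIntegral_congr_fun measurableSet_Ioo fun t ht => ?_
    have h0 := ht.1
    have h1 : 0 < 1 - t := by linarith [ht.2]
    rw [← ENNReal.ofReal_mul (by unfold arcsineDensity; positivity),
      ← ENNReal.ofReal_mul (by positivity), arcsineDensity, Real.sqrt_eq_rpow,
      ← Real.rpow_mul h0.le, show s / 2 + 1 / 2 - 1 = -(1 / 2) + 1 / 2 * s by ring,
      Real.rpow_add h0, show (1 / 2 : ℝ) - 1 = -(1 / 2) by norm_num]
    congr 1
    ring
  rw [h1, setLIntegral_beta (by positivity) (by positivity), ← ENNReal.ofReal_mul (by positivity),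
    ProbabilityTheory.beta, Real.Gamma_one_half_eq, show s / 2 + 1 / 2 + 1 / 2 = s / 2 + 1 by ring]
  congr 1
  have hsq := Real.mul_self_sqrt hpi.le
  have : √Real.pi ≠ 0 := by positivity
  field_simp
  rw [sq, hsq]

/-! ### The series for the Mahler measure -/

/-- The terms of the series expansion of the Mahler measure of `(1 + x)² + y + z`. -/
noncomputable def mahlerTerm (n : ℕ) : ℝ :=
  Real.pi⁻¹ * invSqrtCoeff n * ((1 / 2) ^ (n + 1 / 2 : ℝ) / (n + 1 / 2) ^ 2) *
    (Real.Gamma (n / 2 + 3 / 4) / (√Real.pi * Real.Gamma (n / 2 + 5 / 4)))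

lemma mahlerTerm_nonneg (n : ℕ) : 0 ≤ mahlerTerm n := by
  have := Real.pi_pos
  have := invSqrtCoeff_nonneg n
  have : 0 < Real.Gamma (n / 2 + 3 / 4) := Real.Gamma_pos_of_pos (by positivity)
  have : 0 < Real.Gamma (n / 2 + 5 / 4) := Real.Gamma_pos_of_pos (by positivity)
  unfold mahlerTerm
  positivity

lemma lintegral_posLog_div_eq_tsum :
    ∫⁻ p : ℝ × ℝ, ENNReal.ofReal (Real.posLog
        (‖1 + unitCircleExp p.2‖ / ‖1 + unitCircleExp p.1‖ ^ 2))
        ∂(unitIntervalMeasure.prod unitIntervalMeasure) =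
      ∑' n : ℕ, ENNReal.ofReal (mahlerTerm n) := by
  have hpi := Real.pi_pos
  have hquot (x w : ℝ) : ‖1 + unitCircleExp w‖ / ‖1 + unitCircleExp x‖ ^ 2 =
      (√(Real.cos (Real.pi * w) ^ 2) / 2) / Real.cos (Real.pi * x) ^ 2 := by
    rw [norm_one_add_unitCircleExp, norm_one_add_unitCircleExp, Real.sqrt_sq_eq_abs, mul_pow,
      sq_abs]
    field_simp
  -- The `x`-integral goes inside: for fixed `w` the numerator is the constant `c = √σ/2` of the
  -- previous part.
  rw [lintegral_prod_symm _ (measurable_posLog_div.ennreal_ofReal.aemeasurable)]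
  simp only [hquot]
  have hinner (w : ℝ) := lintegral_cos_sq (fun τ => ENNReal.ofReal (Real.posLog
    ((√(Real.cos (Real.pi * w) ^ 2) / 2) / τ)))
  simp only [hinner]
  rw [lintegral_cos_sq (fun σ => ∫⁻ τ in Set.Ioo 0 1, ENNReal.ofReal (arcsineDensity τ) *
    ENNReal.ofReal (Real.posLog ((√σ / 2) / τ)))]
  have h1 : ∫⁻ σ in Set.Ioo 0 1, ENNReal.ofReal (arcsineDensity σ) *
      ∫⁻ τ in Set.Ioo 0 1, ENNReal.ofReal (arcsineDensity τ) *
        ENNReal.ofReal (Real.posLog ((√σ / 2) / τ)) =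
      ∫⁻ σ in Set.Ioo 0 1, ∑' n : ℕ, ENNReal.ofReal (Real.pi⁻¹ * invSqrtCoeff n *
        ((1 / 2) ^ (n + 1 / 2 : ℝ) / (n + 1 / 2) ^ 2)) *
        (ENNReal.ofReal (arcsineDensity σ) * ENNReal.ofReal (√σ ^ (n + 1 / 2 : ℝ))) := by
    refine setLIntegral_congr_fun measurableSet_Ioo fun σ hσ => ?_
    have h0 : 0 < √σ := Real.sqrt_pos.2 hσ.1
    have hlt : √σ < 1 := (Real.sqrt_lt' one_pos).2 (by simpa using hσ.2)
    rw [lintegral_arcsineDensity_mul_posLog (by positivity) (by linarith), ← ENNReal.tsum_mul_left]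
    congr 1
    funext n
    have := invSqrtCoeff_nonneg n
    have hA : 0 ≤ Real.pi⁻¹ * invSqrtCoeff n * ((1 / 2) ^ (n + 1 / 2 : ℝ) / (n + 1 / 2) ^ 2) := by
      positivity
    rw [mul_left_comm (ENNReal.ofReal (_ * _)), ← ENNReal.ofReal_mul hA,
      div_eq_mul_one_div (√σ), Real.mul_rpow h0.le (by norm_num)]
    congr 2
    ring
  rw [h1, lintegral_tsum]
  · congr 1
    funext n
    have := invSqrtCoeff_nonneg n
    rw [lintegral_const_mul' _ _ ENNReal.ofReal_ne_top,
      lintegral_arcsineDensity_mul_rpow (by positivity), ← ENNReal.ofReal_mul (by positivity),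
      mahlerTerm]
    congr 4
    · ring_nf
    · ring_nf
  · intro n
    unfold arcsineDensity
    fun_prop

lemma logMahlerMeasure_eq_tsum (hs : Summable mahlerTerm) :
    logMahlerMeasure ((1 + MvPolynomial.X 0) ^ 2 + MvPolynomial.X 1 + MvPolynomial.X 2 :
        MvPolynomial (Fin 3) ℂ) = ∑' n, mahlerTerm n := by
  have h := lintegral_posLog_div_eq_tsum
  rw [← ENNReal.ofReal_tsum_of_nonneg mahlerTerm_nonneg hs] at h
  rw [logMahlerMeasure_eq_toReal_lintegral (h ▸ ENNReal.ofReal_ne_top), h,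
    ENNReal.toReal_ofReal (tsum_nonneg mahlerTerm_nonneg)]

/-! ### Identification with the hypergeometric series -/

lemma pochhammer_zero (x : ℝ) : pochhammer x 0 = 1 := by simp [pochhammer]

lemma pochhammer_succ (x : ℝ) (n : ℕ) : pochhammer x (n + 1) = pochhammer x n * (x + n) := by
  simp [pochhammer, ascPochhammer_succ_eval]

lemma hypergeometricTerm_succ {a b : List ℝ} {z : ℝ} {n : ℕ} :
    hypergeometricTerm a b z (n + 1) = hypergeometricTerm a b z n *
      ((a.map fun x => x + (n : ℝ)).prod / (b.map fun x => x + (n : ℝ)).prod * (z / (n + 1))) := by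
  have h (l : List ℝ) : (l.map fun x => pochhammer x (n + 1)).prod =
      (l.map fun x => pochhammer x n).prod * (l.map fun x => x + (n : ℝ)).prod := by
    rw [← List.prod_map_mul]
    simp only [pochhammer_succ]
  rw [hypergeometricTerm, hypergeometricTerm, h, h, Nat.factorial_succ, pow_succ, mul_div_mul_comm]
  push_cast
  rw [mul_comm ((n : ℝ) + 1), mul_div_mul_comm]
  ring

lemma hypergeometricTerm_zero (a b : List ℝ) (z : ℝ) : hypergeometricTerm a b z 0 = 1 := by
  simp [hypergeometricTerm, pochhammer_zero]

lemma summable_of_succ_eq_mul {f r : ℕ → ℝ} (hf : ∀ n, f (n + 1) = f n * r n) (h0 : f 0 = 1)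
    (hr0 : ∀ n, 0 ≤ r n) {q : ℝ} (hr : ∀ n, r n ≤ q) (hq : q < 1) : Summable f := by
  have hf0 (n : ℕ) : 0 ≤ f n := by
    induction n with
    | zero => simp [h0]
    | succ n ih => rw [hf]; exact mul_nonneg ih (hr0 n)
  have hle (n : ℕ) : f n ≤ q ^ n := by
    induction n with
    | zero => simp [h0]
    | succ n ih =>
      rw [hf, pow_succ]
      exact mul_le_mul ih (hr n) (hr0 n) ((hf0 n).trans ih)
  exact Summable.of_nonneg_of_le hf0 hle
    (summable_geometric_of_lt_one ((hr0 0).trans (hr 0)) hq)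

lemma summable_hypergeometricTerm_even :
    Summable (hypergeometricTerm [1/4, 1/4, 1/4, 3/4, 3/4] [1/2, 5/4, 5/4, 5/4] (1/4)) := by
  refine summable_of_succ_eq_mul (q := 1 / 4) (fun n => hypergeometricTerm_succ)
    (hypergeometricTerm_zero _ _ _) (fun n => ?_) (fun n => ?_) (by norm_num)
  · simp only [List.map_cons, List.map_nil, List.prod_cons, List.prod_nil]; positivity
  · simp only [List.map_cons, List.map_nil, List.prod_cons, List.prod_nil]
    -- After clearing denominators, the difference of the two sides expands to a polynomial in `n`
    -- with nonnegative coefficients.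
    rw [div_mul_div_comm, div_le_div_iff₀ (by positivity) (by positivity), ← sub_nonneg]
    ring_nf
    positivity

lemma summable_hypergeometricTerm_odd :
    Summable (hypergeometricTerm [3/4, 3/4, 3/4, 5/4, 5/4] [3/2, 7/4, 7/4, 7/4] (1/4)) := by
  refine summable_of_succ_eq_mul (q := 1 / 4) (fun n => hypergeometricTerm_succ)
    (hypergeometricTerm_zero _ _ _) (fun n => ?_) (fun n => ?_) (by norm_num)
  · simp only [List.map_cons, List.map_nil, List.prod_cons, List.prod_nil]; positivity
  · simp only [List.map_cons, List.map_nil, List.prod_cons, List.prod_nil]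
    rw [div_mul_div_comm, div_le_div_iff₀ (by positivity) (by positivity), ← sub_nonneg]
    ring_nf
    positivity

/-- The Gamma arguments contain `n/2`, so the functional equation applies only when `n` grows by 2;
this is what forces the split by parity. -/
lemma mahlerTerm_add_two (n : ℕ) :
    mahlerTerm (n + 2) = mahlerTerm n * ((n + 1 / 2) * (n + 3 / 2) / ((n + 1) * (n + 2)) * (1 / 4) *
      ((n + 1 / 2) / (n + 5 / 2)) ^ 2 * ((n / 2 + 3 / 4) / (n / 2 + 5 / 4))) := by
  have h1 : Real.Gamma (((n + 2 : ℕ) : ℝ) / 2 + 3 / 4) =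
      (n / 2 + 3 / 4) * Real.Gamma (n / 2 + 3 / 4) := by
    rw [← Real.Gamma_add_one (by positivity)]; push_cast; ring_nf
  have h2 : Real.Gamma (((n + 2 : ℕ) : ℝ) / 2 + 5 / 4) =
      (n / 2 + 5 / 4) * Real.Gamma (n / 2 + 5 / 4) := by
    rw [← Real.Gamma_add_one (by positivity)]; push_cast; ring_nf
  have h3 : ((1 / 2 : ℝ)) ^ (((n + 2 : ℕ) : ℝ) + 1 / 2) = (1 / 4) * (1 / 2) ^ (n + 1 / 2 : ℝ) := by
    rw [show ((n + 2 : ℕ) : ℝ) + 1 / 2 = 2 + (n + 1 / 2) by push_cast; ring,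
      Real.rpow_add (by norm_num)]
    norm_num
  have h4 : invSqrtCoeff (n + 2) =
      invSqrtCoeff n * ((n + 1 / 2) * (n + 3 / 2) / ((n + 1) * (n + 2))) := by
    rw [invSqrtCoeff, invSqrtCoeff, pochhammer_succ, pochhammer_succ, Nat.factorial_succ,
      Nat.factorial_succ]
    push_cast
    field_simp
    ring
  have h5 : Real.Gamma (n / 2 + 5 / 4) ≠ 0 := (Real.Gamma_pos_of_pos (by positivity)).ne'
  have h6 : √Real.pi ≠ 0 := (Real.sqrt_pos.2 Real.pi_pos).ne'
  rw [mahlerTerm, mahlerTerm, h1, h2, h3, h4]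
  push_cast
  have h7 : (n : ℝ) + 2 + 1 / 2 = n + 5 / 2 := by ring
  rw [h7]
  have h8 : (n : ℝ) / 2 + 5 / 4 ≠ 0 := by positivity
  have h9 : (n : ℝ) + 1 / 2 ≠ 0 := by positivity
  have h10 : (n : ℝ) + 5 / 2 ≠ 0 := by positivity
  field_simp

/-- Euler's reflection formula at `1/4`. It turns the Gamma quotients in the two initial terms into
the squares `Γ(3/4)²` and `Γ(1/4)²`. -/
lemma Gamma_one_fourth_mul_Gamma_three_fourths :
    Real.Gamma (1 / 4) * Real.Gamma (3 / 4) = Real.pi * √2 := by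
  have h := Real.Gamma_mul_Gamma_one_sub (1 / 4)
  rw [show (1 : ℝ) - 1 / 4 = 3 / 4 by norm_num, show Real.pi * (1 / 4) = Real.pi / 4 by ring,
    Real.sin_pi_div_four] at h
  rw [h]
  have h2 : √(2 : ℝ) * √2 = 2 := Real.mul_self_sqrt (by norm_num)
  have : √(2 : ℝ) ≠ 0 := by positivity
  field_simp
  linarith

lemma pi_rpow_five_halves : Real.pi ^ (5 / 2 : ℝ) = Real.pi ^ 2 * √Real.pi := by
  rw [show (5 / 2 : ℝ) = 2 + 1 / 2 by norm_num, Real.rpow_add Real.pi_pos, ← Real.sqrt_eq_rpow]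
  norm_num

lemma half_rpow_half : (1 / 2 : ℝ) ^ (1 / 2 : ℝ) = √2 / 2 := by
  rw [← Real.sqrt_eq_rpow, Real.sqrt_div zero_le_one, Real.sqrt_one]
  have h2 : √(2 : ℝ) * √2 = 2 := Real.mul_self_sqrt (by norm_num)
  have : √(2 : ℝ) ≠ 0 := by positivity
  field_simp
  linarith

lemma mahlerTerm_zero :
    mahlerTerm 0 = 8 * Real.Gamma (3/4) ^ 2 / Real.pi ^ (5/2 : ℝ) := by
  have hg := Gamma_one_fourth_mul_Gamma_three_fourths
  have h1 : Real.Gamma (5 / 4) = 1 / 4 * Real.Gamma (1 / 4) := by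
    rw [← Real.Gamma_add_one (by norm_num)]; norm_num
  have h5 : Real.Gamma (1 / 4) ≠ 0 := (Real.Gamma_pos_of_pos (by norm_num)).ne'
  have h6 : √Real.pi ≠ 0 := (Real.sqrt_pos.2 Real.pi_pos).ne'
  have h7 := Real.pi_ne_zero
  rw [mahlerTerm, invSqrtCoeff, pochhammer_zero, pi_rpow_five_halves]
  simp only [Nat.cast_zero, zero_div, zero_add, Nat.factorial_zero, Nat.cast_one, half_rpow_half,
    h1]
  field_simp
  linear_combination (-8) * hg

lemma mahlerTerm_one :
    mahlerTerm 1 = Real.Gamma (1/4) ^ 2 / (54 * Real.pi ^ (5/2 : ℝ)) := by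
  have hg := Gamma_one_fourth_mul_Gamma_three_fourths
  have h1 : Real.Gamma (5 / 4) = 1 / 4 * Real.Gamma (1 / 4) := by
    rw [← Real.Gamma_add_one (by norm_num)]; norm_num
  have h3 : Real.Gamma (7 / 4) = 3 / 4 * Real.Gamma (3 / 4) := by
    rw [← Real.Gamma_add_one (by norm_num)]; norm_num
  have h4 : (1 / 2 : ℝ) ^ (1 + 1 / 2 : ℝ) = √2 / 4 := by
    rw [Real.rpow_add (by norm_num), half_rpow_half, Real.rpow_one]; ring
  have h5 : Real.Gamma (3 / 4) ≠ 0 := (Real.Gamma_pos_of_pos (by norm_num)).ne'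
  have h6 : √Real.pi ≠ 0 := (Real.sqrt_pos.2 Real.pi_pos).ne'
  have h7 := Real.pi_ne_zero
  rw [mahlerTerm, invSqrtCoeff, pochhammer_succ, pochhammer_zero, pi_rpow_five_halves,
    Nat.cast_one, h4, show (1 / 2 + 3 / 4 : ℝ) = 5 / 4 by norm_num,
    show (1 / 2 + 5 / 4 : ℝ) = 7 / 4 by norm_num, h1, h3]
  simp only [Nat.cast_zero, add_zero, Nat.factorial_one, Nat.cast_one]
  field_simp
  linear_combination (-108) * hg

/-- Both sides have the same initial value and the same rational term ratio; the prefactor is the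
zeroth term. -/
lemma mahlerTerm_even (k : ℕ) : mahlerTerm (2 * k) =
    8 * Real.Gamma (3/4) ^ 2 / Real.pi ^ (5/2 : ℝ) *
      hypergeometricTerm [1/4, 1/4, 1/4, 3/4, 3/4] [1/2, 5/4, 5/4, 5/4] (1/4) k := by
  induction k with
  | zero => rw [mul_zero, mahlerTerm_zero, hypergeometricTerm_zero, mul_one]
  | succ k ih =>
    rw [mul_add_one, mahlerTerm_add_two, ih, hypergeometricTerm_succ, mul_assoc, mul_assoc]
    congr 2
    simp only [List.map_cons, List.map_nil, List.prod_cons, List.prod_nil]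
    push_cast
    field_simp
    ring

lemma mahlerTerm_odd (k : ℕ) : mahlerTerm (2 * k + 1) =
    Real.Gamma (1/4) ^ 2 / (54 * Real.pi ^ (5/2 : ℝ)) *
      hypergeometricTerm [3/4, 3/4, 3/4, 5/4, 5/4] [3/2, 7/4, 7/4, 7/4] (1/4) k := by
  induction k with
  | zero => rw [mul_zero, zero_add, mahlerTerm_one, hypergeometricTerm_zero, mul_one]
  | succ k ih =>
    rw [show 2 * (k + 1) + 1 = 2 * k + 1 + 2 by ring, mahlerTerm_add_two, ih,
      hypergeometricTerm_succ, mul_assoc, mul_assoc]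
    congr 2
    simp only [List.map_cons, List.map_nil, List.prod_cons, List.prod_nil]
    push_cast
    field_simp
    ring

theorem theorem3 :
    IntegrableOn
        (logAbsOnTorus ((1 + MvPolynomial.X 0) ^ 2 + MvPolynomial.X 1 + MvPolynomial.X 2 :
          MvPolynomial (Fin 3) ℂ))
        (Set.Icc (0 : Fin 3 → ℝ) 1) volume ∧
    Summable (hypergeometricTerm [1/4, 1/4, 1/4, 3/4, 3/4] [1/2, 5/4, 5/4, 5/4] (1/4)) ∧
    Summable (hypergeometricTerm [3/4, 3/4, 3/4, 5/4, 5/4] [3/2, 7/4, 7/4, 7/4] (1/4)) ∧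
    logMahlerMeasure ((1 + MvPolynomial.X 0) ^ 2 + MvPolynomial.X 1 + MvPolynomial.X 2 :
        MvPolynomial (Fin 3) ℂ) =
      8 * Real.Gamma (3/4) ^ 2 / Real.pi ^ (5/2 : ℝ) *
          hypergeometric [1/4, 1/4, 1/4, 3/4, 3/4] [1/2, 5/4, 5/4, 5/4] (1/4) +
        Real.Gamma (1/4) ^ 2 / (54 * Real.pi ^ (5/2 : ℝ)) *
          hypergeometric [3/4, 3/4, 3/4, 5/4, 5/4] [3/2, 7/4, 7/4, 7/4] (1/4) := by
  have h0 := summable_hypergeometricTerm_even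
  have h1 := summable_hypergeometricTerm_odd
  have heven := (h0.hasSum.mul_left (8 * Real.Gamma (3/4) ^ 2 / Real.pi ^ (5/2 : ℝ)))
  have hodd := (h1.hasSum.mul_left (Real.Gamma (1/4) ^ 2 / (54 * Real.pi ^ (5/2 : ℝ))))
  simp only [← mahlerTerm_even] at heven
  simp only [← mahlerTerm_odd] at hodd
  have hsum := heven.even_add_odd hodd
  refine ⟨integrableOn_logAbsOnTorus, h0, h1, ?_⟩
  rw [logMahlerMeasure_eq_tsum hsum.summable, hsum.tsum_eq]
  rfl
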